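/- All quantum systems are finite-dimensional and nonzero; $|X|$ is the dimension of the system $X$, $\mathbf u^{B}=I^{B}/|B|$ is the uniform state, and a channel is a completely positive trace-preserving linear map. Let $A,A',B$ be quantum systems and let $\Theta$ be a quantum superchannel from maps $A\to B$ to maps $A'\to B$: a linear map from the linear maps $\mathcal N^{A\to B}$ to the linear maps $A'\to B$ such that $\Theta[\mathcal N]$ is trace-preserving whenever $\mathcal N$ is, and, for all systems $C_0,C_1$, $\Theta\otimes\mathbb 1^{(C_0\to C_1)}$ (with $\mathbb 1^{(C_0\to C_1)}$ the identity on the linear maps $C_0\to C_1$) takes completely positive maps $AC_0\to BC_1$ to completely positive maps $A'C_0\to BC_1$. A realization of $\Theta$ consists of a system $R$, a channel $\mathcal E^{RB\to B}$ and an isometry $V:A'\to R\otimes A$ such that, with $\mathcal V(\rho)=V\rho V^\dagger$, $$\Theta[\mathcal N]=\mathcal E^{RB\to B}\circ(\mathsf{id}^R\otimes\mathcal N^{A\to B})\circ\mathcal V^{A'\to RA}\qquad\text{for all linear maps }\mathcal N^{A\to B}.$$ It is a standard form of $\Theta$ if $|R|$ is minimal among all realizations of $\Theta$. A channel $\mathcal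 E^{RB\to B}$ is conditionally unital if for every state $\tau$ on $R$ the map $\omega\mapsto\mathcal E(\tau\otimes\omega)$ is a doubly stochastic (i.e. unital) channel on $B$. The superchannel $\Theta$ is a mixing operation if it has a standard form in which $\mathcal E$ is conditionally unital. A channel $\mathcal N^{X\to BC}$ is marginally uniform with respect to $B$ if $\mathcal N=\mathbf u^B\otimes(\mathrm{Tr}_B\circ\mathcal N)$. Finally, $\Theta$ is completely uniformity-preserving if, for all systems $C_0,C_1$ and every channel $\mathcal N^{AC_0\to BC_1}$ that is marginally uniform with respect to $B$, the channel $(\Theta\otimes\mathbb 1^{(C_0\to C_1)})[\mathcal N]$ is marginally uniform with respect to $B$. **Theorem 11.** For every quantum superchannel $\Theta$ as above the following are equivalent: 1. $\Theta$ is completely uniformity-preserving. 2. The channel $(\Theta\otimes\mathbb 1^{C})[\mathbf u^{B}\otimes\mathsf{id}^{A\to C}]$ from $A'$ to $BC$ is marginally uniform with respect to $B$, where $C$ is a replica of $A$, $C_0$ is trivial and $C_1=C$. 3. $\Theta$ is a mixing operation. Moreover, for every standard form $(R,\mathcal E,\mathcal V)$ of $\Theta$, the channel $\mathcal E$ is conditionally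 unital if and only if $\Theta$ is completely uniformity-preserving. -/

import Mathlib

open Matrix
open scoped Kronecker ComplexOrder

namespace QChan

/-- Operators on the finite-dimensional quantum system `ℂ^X`. -/
abbrev Op (X : Type) : Type := Matrix X X ℂ

/-- `ρ` is a density matrix (a state). -/
def IsState {X : Type} [Fintype X] (ρ : Op X) : Prop :=
  ρ.PosSemidef ∧ ρ.trace = 1

/-- The maximally mixed (uniform) state. -/
noncomputable def uniform (X : Type) [Fintype X] [DecidableEq X] : Op X :=
  (Fintype.card X : ℂ)⁻¹ • (1 : Op X)

/-- The `(c, c')` block of an operator on `X ⊗ C`: `(id ⊗ ⟨c|) ρ (id ⊗ |c'⟩)`. -/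
def blockR {X C : Type} (ρ : Op (X × C)) (c c' : C) : Op X :=
  Matrix.of fun x x' => ρ (x, c) (x', c')

/-- The `(c, c')` block of an operator on `C ⊗ X`: `(⟨c| ⊗ id) ρ (|c'⟩ ⊗ id)`. -/
def blockL {C X : Type} (ρ : Op (C × X)) (c c' : C) : Op X :=
  Matrix.of fun x x' => ρ (c, x) (c', x')

/-- The map `Φ ⊗ id` from operators on `X ⊗ C` to operators on `Y ⊗ C`. -/
def tensorId {X Y : Type} (Φ : Op X →ₗ[ℂ] Op Y) (C : Type) :
    Op (X × C) →ₗ[ℂ] Op (Y × C) where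
  toFun ρ := Matrix.of fun p q => Φ (blockR ρ p.2 q.2) p.1 q.1
  map_add' ρ σ := by
    ext p q
    have h : blockR (ρ + σ) p.2 q.2 = blockR ρ p.2 q.2 + blockR σ p.2 q.2 := rfl
    simp [h]
  map_smul' z ρ := by
    ext p q
    have h : blockR (z • ρ) p.2 q.2 = z • blockR ρ p.2 q.2 := rfl
    simp [h]

/-- The map `id ⊗ Φ` from operators on `C ⊗ X` to operators on `C ⊗ Y`. -/
def idTensor (C : Type) {X Y : Type} (Φ : Op X →ₗ[ℂ] Op Y) :
    Op (C × X) →ₗ[ℂ] Op (C × Y) where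
  toFun ρ := Matrix.of fun p q => Φ (blockL ρ p.1 q.1) p.2 q.2
  map_add' ρ σ := by
    ext p q
    have h : blockL (ρ + σ) p.1 q.1 = blockL ρ p.1 q.1 + blockL σ p.1 q.1 := rfl
    simp [h]
  map_smul' z ρ := by
    ext p q
    have h : blockL (z • ρ) p.1 q.1 = z • blockL ρ p.1 q.1 := rfl
    simp [h]

/-- Complete positivity: `Φ ⊗ id` preserves positivity for every finite-dimensional ancilla. -/
def IsCP {X Y : Type} (Φ : Op X →ₗ[ℂ] Op Y) : Prop :=
  ∀ (n : ℕ) (ρ : Op (X × Fin n)), ρ.PosSemidef → (tensorId Φ (Fin n) ρ).PosSemidef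

/-- Trace preservation. -/
def IsTP {X Y : Type} [Fintype X] [Fintype Y] (Φ : Op X →ₗ[ℂ] Op Y) : Prop :=
  ∀ ρ : Op X, (Φ ρ).trace = ρ.trace

/-- Quantum channels: completely positive trace-preserving maps. -/
def IsChannel {X Y : Type} [Fintype X] [Fintype Y] (Φ : Op X →ₗ[ℂ] Op Y) : Prop :=
  IsCP Φ ∧ IsTP Φ

/-- Doubly stochastic (unital) channels. -/
def IsDoublyStochastic {X : Type} [Fintype X] [DecidableEq X] (Φ : Op X →ₗ[ℂ] Op X) : Prop :=
  IsChannel Φ ∧ Φ 1 = 1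

/-- The map `ρ ↦ V ρ V†`. -/
def conj {X Y : Type} [Fintype X] (V : Matrix Y X ℂ) : Op X →ₗ[ℂ] Op Y where
  toFun ρ := V * ρ * Vᴴ
  map_add' ρ σ := by simp [Matrix.mul_add, Matrix.add_mul]
  map_smul' z ρ := by simp

/-- Partial trace over the first factor. -/
def trLeft {B C : Type} [Fintype B] (ρ : Op (B × C)) : Op C :=
  ∑ b : B, blockL ρ b b

/-- `N : X → B ⊗ C` is marginally uniform with respect to `B`:
`N = u^B ⊗ N^{X → C}` with `N^{X → C} = Tr_B ∘ N`. -/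
def IsMarginallyUniform {X B C : Type} [Fintype B] [DecidableEq B]
    (N : Op X →ₗ[ℂ] Op (B × C)) : Prop :=
  ∀ ρ : Op X, N ρ = uniform B ⊗ₖ trLeft (N ρ)

/-- Linear supermaps, taking linear maps `A → B` to linear maps `A' → B'`. -/
abbrev Supermap (A B A' B' : Type) : Type :=
  (Op A →ₗ[ℂ] Op B) →ₗ[ℂ] (Op A' →ₗ[ℂ] Op B')

/-- For `N : A ⊗ C₀ → B ⊗ C₁`, the map
`X ↦ (id ⊗ ⟨c₁|) N(X ⊗ |c₀⟩⟨c₀'|) (id ⊗ |c₁'⟩)` from `A` to `B`; thus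
`N = ∑ component N c₀ c₀' c₁ c₁' ⊗ (ω ↦ ⟨c₀|ω|c₀'⟩ |c₁⟩⟨c₁'|)`. -/
def component {A B C₀ C₁ : Type} [DecidableEq C₀]
    (N : Op (A × C₀) →ₗ[ℂ] Op (B × C₁)) (c₀ c₀' : C₀) (c₁ c₁' : C₁) :
    Op A →ₗ[ℂ] Op B where
  toFun X := blockR (N (X ⊗ₖ Matrix.single c₀ c₀' (1 : ℂ))) c₁ c₁'
  map_add' X Y := by
    rw [Matrix.add_kronecker, map_add]; rfl
  map_smul' z X := by
    rw [Matrix.smul_kronecker, map_smul]; rfl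

/-- The action of `Θ ⊗ 𝟙^(C₀ → C₁)` on a map `N : A ⊗ C₀ → B ⊗ C₁`, where `𝟙` is the identity
supermap on maps `C₀ → C₁`: the supermap `Θ` is applied to the `A → B` components of `N`. -/
def extend {A B A' B' : Type} (Θ : Supermap A B A' B') {C₀ C₁ : Type} [Fintype C₀]
    [DecidableEq C₀] (N : Op (A × C₀) →ₗ[ℂ] Op (B × C₁)) :
    Op (A' × C₀) →ₗ[ℂ] Op (B' × C₁) where
  toFun Y := Matrix.of fun p q =>
    ∑ c₀ : C₀, ∑ c₀' : C₀, Θ (component N c₀ c₀' p.2 q.2) (blockR Y c₀ c₀') p.1 q.1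
  map_add' Y Z := by
    ext p q
    have h : ∀ c c', blockR (Y + Z) c c' = blockR Y c c' + blockR Z c c' := fun _ _ => rfl
    simp [h, Finset.sum_add_distrib]
  map_smul' z Y := by
    ext p q
    have h : ∀ c c', blockR (z • Y) c c' = z • blockR Y c c' := fun _ _ => rfl
    simp [h, Finset.mul_sum]

/-- A superchannel is a linear supermap that is completely CP-preserving and trace-preservation
preserving. -/
def IsSuperchannel {A B A' B' : Type} [Fintype A] [Fintype B] [Fintype A'] [Fintype B']
    (Θ : Supermap A B A' B') : Prop :=
  (∀ (C₀ C₁ : Type) [Fintype C₀] [DecidableEq C₀] [Fintype C₁] [DecidableEq C₁]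
    (N : Op (A × C₀) →ₗ[ℂ] Op (B × C₁)), IsCP N → IsCP (extend Θ N)) ∧
  ∀ N : Op A →ₗ[ℂ] Op B, IsTP N → IsTP (Θ N)

/-- `Θ` is implemented by the auxiliary system `R`, the post-processing channel `E : R ⊗ B → B`
and the pre-processing isometry `V : A' → R ⊗ A`, that is, `Θ[N] = E ∘ (id_R ⊗ N) ∘ 𝒱`
with `𝒱(ρ) = V ρ V†`. -/
def IsRealization {A B A' R : Type} [Fintype A] [Fintype B] [Fintype A'] [DecidableEq A']
    [Fintype R] (Θ : Supermap A B A' B)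
    (E : Op (R × B) →ₗ[ℂ] Op B) (V : Matrix (R × A) A' ℂ) : Prop :=
  IsChannel E ∧ Vᴴ * V = 1 ∧
    ∀ N : Op A →ₗ[ℂ] Op B, Θ N = E ∘ₗ idTensor R N ∘ₗ conj V

/-- A realization is a standard form if its auxiliary system has the smallest dimension among all
realizations of `Θ`. -/
def IsStandardForm {A B A' R : Type} [Fintype A] [Fintype B] [Fintype A'] [DecidableEq A']
    [Fintype R] (Θ : Supermap A B A' B)
    (E : Op (R × B) →ₗ[ℂ] Op B) (V : Matrix (R × A) A' ℂ) : Prop :=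
  IsRealization Θ E V ∧
    ∀ (r : ℕ) (E' : Op (Fin r × B) →ₗ[ℂ] Op B) (V' : Matrix (Fin r × A) A' ℂ),
      IsRealization Θ E' V' → Fintype.card R ≤ r

/-- The map `E_τ(ω) = E(τ ⊗ ω)`. -/
def condMap {R B : Type} (E : Op (R × B) →ₗ[ℂ] Op B) (τ : Op R) : Op B →ₗ[ℂ] Op B where
  toFun ω := E (τ ⊗ₖ ω)
  map_add' ω ω' := by rw [Matrix.kronecker_add, map_add]
  map_smul' z ω := by rw [Matrix.kronecker_smul, map_smul]; rfl

/-- `E : R ⊗ B → B` is conditionally unital: `E_τ` is doubly stochastic for every state `τ`. -/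
def IsConditionallyUnital {R B : Type} [Fintype R] [Fintype B] [DecidableEq B]
    (E : Op (R × B) →ₗ[ℂ] Op B) : Prop :=
  ∀ τ : Op R, IsState τ → IsDoublyStochastic (condMap E τ)

/-- `Θ` is a mixing operation: in standard form, its post-processing channel is conditionally
unital. -/
def IsMixing {A B A' : Type} [Fintype A] [Fintype B] [DecidableEq B] [Fintype A']
    [DecidableEq A'] (Θ : Supermap A B A' B) : Prop :=
  ∃ (r : ℕ) (E : Op (Fin r × B) →ₗ[ℂ] Op B) (V : Matrix (Fin r × A) A' ℂ),
    IsStandardForm Θ E V ∧ IsConditionallyUnital E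

/-- `Θ` is completely uniformity-preserving. -/
def IsCompletelyUniformityPreserving {A B A' B' : Type} [Fintype A] [Fintype B] [DecidableEq B]
    [Fintype B'] [DecidableEq B'] (Θ : Supermap A B A' B') : Prop :=
  ∀ (C₀ C₁ : Type) [Fintype C₀] [DecidableEq C₀] [Fintype C₁] [DecidableEq C₁]
    (N : Op (A × C₀) →ₗ[ℂ] Op (B × C₁)),
    IsChannel N → IsMarginallyUniform N → IsMarginallyUniform (extend Θ N)

/-- The channel `u^B ⊗ id^{A → C}`, with `C` a replica of `A`, sending `ρ` to `u^B ⊗ ρ`. The input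
is written as `A ⊗ C₀` with `C₀` the trivial one-dimensional system. -/
noncomputable def uniformId (A B : Type) [Fintype B] [DecidableEq B] :
    Op (A × Unit) →ₗ[ℂ] Op (B × A) where
  toFun ρ := uniform B ⊗ₖ blockR ρ () ()
  map_add' ρ σ := by
    rw [← Matrix.kronecker_add]; rfl
  map_smul' z ρ := by
    rw [RingHom.id_apply, ← Matrix.kronecker_smul]; rfl

end QChan

/-!
The Choi matrix of a superchannel `Θ` is positive, and since `Θ` preserves trace preservation,
tracing out the output leaves `Q ⊗ 1` for an operator `Q` on `A ⊗ A'` with partial trace `1` on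
`A'`. Two purifications of the same operator differ by an isometry of the purifying systems; for
purifications of `Q ⊗ 1` coming from the Choi matrix and from `Q`, this isometry is a dilation of
the channel `E` of a realization `(E, V)`.

If `|R|` is minimal, the vectors `(id ⊗ ⟨a|) V |c⟩` span `R`, as otherwise `R` could be compressed
to their span. So applying `Θ` to `u ⊗ id` tests `E (X ⊗ u) ∈ ℂ u` for operators `X` that span all
operators on `R`, and this is conditional unitality. Conversely, the components of a marginally
uniform channel have the form `X ↦ f(X) u`, and a realization of `Θ` maps them into the span of the
operators `E (X ⊗ u)`.
-/

namespace QChan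

section Factorization

variable {𝕜 : Type*} [RCLike 𝕜]

theorem exists_isometry_onto_range {m n : Type*} [Fintype m] [Fintype n] (M : Matrix m n 𝕜) :
    ∃ (r : ℕ) (W : Matrix m (Fin r) 𝕜) (K : Matrix n (Fin r) 𝕜),
      Wᴴ * W = 1 ∧ W * Wᴴ * M = M ∧ M * K = W := by
  classical
  let f := M.toEuclideanLin
  let b := stdOrthonormalBasis 𝕜 (LinearMap.range f)
  choose x hx using fun k => (b k).2
  let W : Matrix m (Fin _) 𝕜 := Matrix.of fun i k => (b k : EuclideanSpace 𝕜 m) i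
  refine ⟨_, W, Matrix.of fun j k => x k j, ?_, ?_, ?_⟩
  · ext k l
    have h := orthonormal_iff_ite.1 b.orthonormal k l
    rw [Submodule.coe_inner, EuclideanSpace.inner_eq_star_dotProduct] at h
    simpa [W, mul_apply, one_apply, dotProduct, mul_comm] using h
  · ext i j
    have h := congrArg (fun v : LinearMap.range f => (v : EuclideanSpace 𝕜 m) i)
      (b.sum_repr' ⟨f (EuclideanSpace.single j 1), LinearMap.mem_range_self _ _⟩)
    rw [Matrix.mul_assoc]
    simpa [W, f, mul_apply, EuclideanSpace.inner_eq_star_dotProduct, dotProduct, mul_comm] using h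
  · ext i k
    simp [W, ← hx, f, mul_apply, mulVec, dotProduct]

open scoped MatrixOrder in
theorem exists_eq_mul_conjTranspose_of_posSemidef {X : Type*} [Fintype X] {P : Matrix X X 𝕜}
    (hP : P.PosSemidef) : ∃ S : Matrix X X 𝕜, P = S * Sᴴ := by
  classical
  exact CStarAlgebra.nonneg_iff_eq_mul_star_self.1 hP.nonneg

theorem exists_leftInvertible_mul_conjTranspose_of_posSemidef {X : Type*} [Fintype X]
    {P : Matrix X X 𝕜} (hP : P.PosSemidef) :
    ∃ (r : ℕ) (T : Matrix X (Fin r) 𝕜) (L : Matrix (Fin r) X 𝕜), P = T * Tᴴ ∧ L * T = 1 := by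
  obtain ⟨S, rfl⟩ := exists_eq_mul_conjTranspose_of_posSemidef hP
  obtain ⟨r, W, K, hW, hWS, hK⟩ := exists_isometry_onto_range Sᴴ
  refine ⟨r, S * W, Kᴴ, ?_, ?_⟩
  · rw [conjTranspose_mul, Matrix.mul_assoc, ← Matrix.mul_assoc W, hWS]
  · rw [← Matrix.mul_assoc, ← conjTranspose_conjTranspose S, ← conjTranspose_mul, hK, hW]

theorem exists_coisometry_of_mul_conjTranspose_eq {X Y Z : Type*} [Fintype X] [Fintype Y]
    [DecidableEq Y] [Fintype Z] {M : Matrix X Z 𝕜} {N : Matrix X Y 𝕜} {L : Matrix Y X 𝕜}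
    (h : M * Mᴴ = N * Nᴴ) (hL : L * N = 1) : ∃ W : Matrix Y Z 𝕜, W * Wᴴ = 1 ∧ N * W = M := by
  classical
  refine ⟨L * M, ?_, ?_⟩
  · calc L * M * (L * M)ᴴ = L * (M * Mᴴ) * Lᴴ := by
          simp only [conjTranspose_mul, Matrix.mul_assoc]
      _ = L * N * (L * N)ᴴ := by simp only [h, conjTranspose_mul, Matrix.mul_assoc]
      _ = 1 := by rw [hL, conjTranspose_one, Matrix.mul_one]
  · have h0 : (1 - N * L) * (M * Mᴴ) = 0 := by
      rw [h, ← Matrix.mul_assoc, Matrix.sub_mul, Matrix.mul_assoc N, hL, Matrix.one_mul,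
        Matrix.mul_one, sub_self, Matrix.zero_mul]
    rw [mul_self_mul_conjTranspose_eq_zero, Matrix.sub_mul, Matrix.one_mul, sub_eq_zero,
      Matrix.mul_assoc] at h0
    exact h0.symm

end Factorization

section Span

open scoped MatrixOrder Matrix.Norms.L2Operator in
theorem span_posSemidef (X : Type) [Finite X] :
    Submodule.span ℂ {P : Op X | P.PosSemidef} = ⊤ := by
  cases nonempty_fintype X
  classical
  simpa only [Matrix.nonneg_iff_posSemidef] using CStarAlgebra.span_nonneg (A := Op X)

theorem span_isState (X : Type) [Fintype X] :
    Submodule.span ℂ {τ : Op X | IsState τ} = ⊤ := by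
  rw [eq_top_iff, ← span_posSemidef, Submodule.span_le]
  intro P (hP : P.PosSemidef)
  by_cases ht : P.trace = 0
  · rw [hP.trace_eq_zero_iff.1 ht]
    exact zero_mem _
  · have hτ : IsState (P.trace⁻¹ • P) :=
      ⟨hP.smul (inv_nonneg.2 hP.trace_nonneg), by
        rw [trace_smul, smul_eq_mul, inv_mul_cancel₀ ht]⟩
    rw [← smul_inv_smul₀ ht P]
    exact Submodule.smul_mem _ _ (Submodule.subset_span hτ)

theorem apply_kronecker_mem_of_span_eq_top {R B : Type} {E : Op (R × B) →ₗ[ℂ] Op B} {σ : Op B}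
    {p : Submodule ℂ (Op B)} {s : Set (Op R)} (hs : Submodule.span ℂ s = ⊤)
    (h : ∀ X ∈ s, E (X ⊗ₖ σ) ∈ p) (X : Op R) : E (X ⊗ₖ σ) ∈ p := by
  have hX : X ∈ Submodule.span ℂ s := hs ▸ Submodule.mem_top
  induction hX using Submodule.span_induction with
  | mem X hX => exact h X hX
  | zero => simp
  | add X Y _ _ hX hY =>
    rw [add_kronecker, map_add]
    exact add_mem hX hY
  | smul z X _ hX =>
    rw [smul_kronecker, map_smul]
    exact p.smul_mem z hX

end Span

section MatrixUnits

theorem conj_mul {X Y Z : Type} [Fintype X] [Fintype Y] (K : Matrix Z Y ℂ) (L : Matrix Y X ℂ) :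
    conj (K * L) = conj K ∘ₗ conj L :=
  LinearMap.ext fun ρ => by
    change K * L * ρ * (K * L)ᴴ = K * (L * ρ * Lᴴ) * Kᴴ
    simp only [conjTranspose_mul, Matrix.mul_assoc]

theorem conj_one {X : Type} [Fintype X] [DecidableEq X] :
    conj (1 : Op X) = LinearMap.id :=
  LinearMap.ext fun ρ => by
    change 1 * ρ * 1ᴴ = ρ
    rw [conjTranspose_one, Matrix.one_mul, Matrix.mul_one]

theorem conj_kronecker {X Y X' Y' : Type} [Fintype X] [Fintype X'] (K : Matrix Y X ℂ)
    (L : Matrix Y' X' ℂ) (ρ : Op X) (σ : Op X') :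
    conj (K ⊗ₖ L) (ρ ⊗ₖ σ) = conj K ρ ⊗ₖ conj L σ := by
  change K ⊗ₖ L * ρ ⊗ₖ σ * (K ⊗ₖ L)ᴴ = (K * ρ * Kᴴ) ⊗ₖ (L * σ * Lᴴ)
  rw [conjTranspose_kronecker, ← mul_kronecker_mul, ← mul_kronecker_mul]

theorem conj_single_apply {X Y : Type} [Fintype X] [DecidableEq X] (K : Matrix Y X ℂ)
    (x x' : X) (y y' : Y) : conj K (single x x' 1) y y' = K y x * star (K y' x') := by
  simp [conj, mul_apply, single_apply, ite_and]

theorem blockR_single {X C : Type} [DecidableEq X] [DecidableEq C] (x x' : X) (c c' : C) (z : ℂ)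
    (d d' : C) :
    blockR (single (x, c) (x', c') z) d d' = if c = d ∧ c' = d' then single x x' z else 0 := by
  ext y y'
  split_ifs <;> simp_all [blockR, single_apply]

theorem linearMap_ext_kronecker {S X Y M : Type*} [CommSemiring S] [Finite X] [Finite Y]
    [AddCommMonoid M] [Module S M] {F G : Matrix (X × Y) (X × Y) S →ₗ[S] M}
    (h : ∀ (ρ : Matrix X X S) (σ : Matrix Y Y S), F (ρ ⊗ₖ σ) = G (ρ ⊗ₖ σ)) : F = G := by
  classical
  refine Matrix.ext_linearMap S fun i j => LinearMap.ext fun z => ?_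
  simpa [single_kronecker_single] using h (single i.1 j.1 z) (single i.2 j.2 1)

theorem trace_single_one {S X : Type*} [Semiring S] [Fintype X] [DecidableEq X] (x x' : X) :
    (single x x' (1 : S)).trace = (1 : Matrix X X S) x x' := by
  obtain rfl | h := eq_or_ne x x'
  · rw [trace_single_eq_same, one_apply_eq]
  · rw [trace_single_eq_of_ne _ _ _ h, one_apply_ne h]

end MatrixUnits

section Channel

variable {X Y Z C : Type}

theorem tensorId_kronecker (Φ : Op X →ₗ[ℂ] Op Y) (ρ : Op X) (σ : Op C) :
    tensorId Φ C (ρ ⊗ₖ σ) = Φ ρ ⊗ₖ σ := by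
  ext ⟨y, c⟩ ⟨y', c'⟩
  have h : blockR (ρ ⊗ₖ σ) c c' = σ c c' • ρ := by
    ext x x'
    exact mul_comm _ _
  change Φ (blockR (ρ ⊗ₖ σ) c c') y y' = Φ ρ y y' * σ c c'
  rw [h, map_smul, Matrix.smul_apply, smul_eq_mul, mul_comm]

theorem idTensor_kronecker (Φ : Op X →ₗ[ℂ] Op Y) (σ : Op C) (ρ : Op X) :
    idTensor C Φ (σ ⊗ₖ ρ) = σ ⊗ₖ Φ ρ := by
  ext ⟨c, y⟩ ⟨c', y'⟩
  exact congrArg (fun M : Op Y => M y y') (map_smul Φ (σ c c') ρ)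

theorem idTensor_comp_conj {R S : Type} [Finite R] [Fintype S] [Fintype X] [DecidableEq X]
    [Fintype Y] [DecidableEq Y] (W : Matrix R S ℂ) (Φ : Op X →ₗ[ℂ] Op Y) :
    idTensor R Φ ∘ₗ conj (W ⊗ₖ (1 : Op X)) = conj (W ⊗ₖ (1 : Op Y)) ∘ₗ idTensor S Φ :=
  linearMap_ext_kronecker fun σ ρ => by
    simp only [LinearMap.comp_apply, conj_kronecker, idTensor_kronecker, conj_one,
      LinearMap.id_apply]

theorem tensorId_conj [Fintype X] [Fintype C] [DecidableEq C] (K : Matrix Y X ℂ) :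
    tensorId (conj K) C = conj (K ⊗ₖ (1 : Op C)) :=
  linearMap_ext_kronecker fun ρ σ => by
    rw [tensorId_kronecker, conj_kronecker, conj_one, LinearMap.id_apply]

theorem IsCP.posSemidef_tensorId [Finite C] {Φ : Op X →ₗ[ℂ] Op Y} (hΦ : IsCP Φ)
    {ρ : Op (X × C)} (hρ : ρ.PosSemidef) : (tensorId Φ C ρ).PosSemidef := by
  obtain ⟨n, ⟨e⟩⟩ := Finite.exists_equiv_fin C
  have h := (hΦ n _ (hρ.submatrix (Prod.map id e.symm))).submatrix (Prod.map id e : Y × C → _)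
  convert h using 1
  ext p q
  simp [tensorId, blockR]

theorem IsCP.posSemidef_apply {Φ : Op X →ₗ[ℂ] Op Y} (hΦ : IsCP Φ) {ρ : Op X}
    (hρ : ρ.PosSemidef) : (Φ ρ).PosSemidef :=
  (hΦ.posSemidef_tensorId (C := Unit) (hρ.submatrix Prod.fst)).submatrix fun y => (y, ())

/-- The unnormalized maximally entangled vector `∑ x, |x⟩ ⊗ |x⟩`, whose image under `Φ ⊗ id` is
the Choi matrix of `Φ`. -/
def maxEntangled (X : Type) [DecidableEq X] : X × X → ℂ :=
  fun p => if p.1 = p.2 then 1 else 0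

theorem IsCP.posSemidef_choi [Finite X] [DecidableEq X] {Φ : Op X →ₗ[ℂ] Op Y} (hΦ : IsCP Φ) :
    (Matrix.of fun p q : Y × X => Φ (single p.2 q.2 1) p.1 q.1).PosSemidef := by
  convert hΦ.posSemidef_tensorId (posSemidef_vecMulVec_self_star (maxEntangled X)) using 1
  ext p q
  refine congrArg (fun M => Φ M p.1 q.1) ?_
  ext x x'
  simp only [blockR, of_apply, vecMulVec_apply, maxEntangled, Pi.star_apply, single_apply,
    eq_comm (a := p.2), eq_comm (a := q.2), ite_and]
  split_ifs <;> simp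

theorem IsCP.comp {Ψ : Op Y →ₗ[ℂ] Op Z} {Φ : Op X →ₗ[ℂ] Op Y} (hΨ : IsCP Ψ) (hΦ : IsCP Φ) :
    IsCP (Ψ ∘ₗ Φ) :=
  fun n ρ hρ => hΨ n _ (hΦ n ρ hρ)

theorem IsChannel.comp [Fintype X] [Fintype Y] [Fintype Z] {Ψ : Op Y →ₗ[ℂ] Op Z}
    {Φ : Op X →ₗ[ℂ] Op Y} (hΨ : IsChannel Ψ) (hΦ : IsChannel Φ) : IsChannel (Ψ ∘ₗ Φ) :=
  ⟨hΨ.1.comp hΦ.1, fun ρ => (hΨ.2 _).trans (hΦ.2 ρ)⟩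

theorem isCP_conj [Fintype X] [Finite Y] (K : Matrix Y X ℂ) : IsCP (conj K) := by
  intro n ρ hρ
  cases nonempty_fintype Y
  rw [tensorId_conj]
  exact hρ.mul_mul_conjTranspose_same _

theorem isChannel_conj [Fintype X] [DecidableEq X] [Fintype Y] {V : Matrix Y X ℂ}
    (hV : Vᴴ * V = 1) : IsChannel (conj V) := by
  refine ⟨isCP_conj V, fun ρ => ?_⟩
  change (V * ρ * Vᴴ).trace = _
  rw [trace_mul_cycle, hV, Matrix.one_mul]

theorem isChannel_kronecker_left [Fintype X] [Fintype Y] {τ : Op X} (hτ : IsState τ) :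
    IsChannel (kroneckerBilinear τ : Op Y →ₗ[ℂ] Op (X × Y)) := by
  refine ⟨fun n ρ hρ => ?_, fun ρ => ?_⟩
  · exact (hτ.1.kronecker hρ).submatrix (Equiv.prodAssoc X Y (Fin n))
  · exact (trace_kronecker τ ρ).trans (by rw [hτ.2, one_mul])

theorem isChannel_condMap {R B : Type} [Fintype R] [Fintype B] {E : Op (R × B) →ₗ[ℂ] Op B}
    (hE : IsChannel E) {τ : Op R} (hτ : IsState τ) : IsChannel (condMap E τ) := by
  have h : condMap E τ = E ∘ₗ kroneckerBilinear (R := ℂ) τ := LinearMap.ext fun _ => rfl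
  rw [h]
  exact hE.comp (isChannel_kronecker_left hτ)

/-- Partial trace over the second factor, the counterpart of `trLeft` as a linear map. -/
def trRight (X C : Type) [Fintype C] : Op (X × C) →ₗ[ℂ] Op X where
  toFun ρ := ∑ c, blockR ρ c c
  map_add' _ _ := Finset.sum_add_distrib
  map_smul' _ _ := by rw [RingHom.id_apply, Finset.smul_sum]; rfl

theorem trRight_apply [Fintype C] (ρ : Op (X × C)) (x x' : X) :
    trRight X C ρ x x' = ∑ c, ρ (x, c) (x', c) := by
  simp [trRight, Matrix.sum_apply, blockR]

theorem trRight_mul_conjTranspose {K : Type} [Fintype C] [Fintype K] {S : Matrix (X × C) K ℂ}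
    {M : Matrix X (C × K) ℂ} (hM : ∀ x c k, M x (c, k) = S (x, c) k) :
    trRight X C (S * Sᴴ) = M * Mᴴ := by
  ext x x'
  simp only [trRight_apply, mul_apply, conjTranspose_apply, Fintype.sum_prod_type, hM]

theorem isChannel_trRight [Fintype X] [Fintype C] : IsChannel (trRight X C) := by
  refine ⟨fun n ρ hρ => ?_, fun ρ => ?_⟩
  · have h : tensorId (trRight X C) (Fin n) ρ =
        ∑ c, ρ.submatrix (fun p => ((p.1, c), p.2)) fun p => ((p.1, c), p.2) := by
      ext p q
      rw [Matrix.sum_apply]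
      exact trRight_apply _ _ _
    rw [h]
    exact posSemidef_sum _ fun c _ => hρ.submatrix _
  · simp only [trace, diag_apply, trRight_apply, Fintype.sum_prod_type]

end Channel

section Supermap

variable {A B A' B' : Type}

/-- The map `X ↦ ⟨a|X|a'⟩ σ`. These maps play the role of the matrix units of `A → B`. -/
def entryMap (a a' : A) (σ : Op B) : Op A →ₗ[ℂ] Op B :=
  (entryLinearMap ℂ ℂ a a').smulRight σ

theorem entryMap_apply (a a' : A) (σ : Op B) (X : Op A) : entryMap a a' σ X = X a a' • σ := rfl

/-- The Choi matrix of a supermap, an operator on `A ⊗ A' ⊗ B ⊗ B'`. -/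
def choi [DecidableEq B] [DecidableEq A'] (Θ : Supermap A B A' B') :
    Op (((A × A') × B) × B') :=
  Matrix.of fun p q => Θ (entryMap p.1.1.1 q.1.1.1 (single p.1.2 q.1.2 1))
    (single p.1.1.2 q.1.1.2 1) p.2 q.2

theorem eq_sum_entryMap [Fintype A] [DecidableEq A] (N : Op A →ₗ[ℂ] Op B) :
    N = ∑ a, ∑ a', entryMap a a' (N (single a a' 1)) := by
  ext X : 1
  conv_lhs => rw [matrix_eq_sum_single X]
  simp only [map_sum, LinearMap.sum_apply, entryMap_apply, ← map_smul, smul_single, smul_eq_mul,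
    mul_one]

theorem choi_injective [Finite A] [Finite B] [DecidableEq B] [Finite A']
    [DecidableEq A'] : Function.Injective (choi : Supermap A B A' B' → _) := by
  cases nonempty_fintype A
  classical
  intro Θ Θ' h
  have hunit : ∀ (a a' : A) (b b' : B),
      Θ (entryMap a a' (single b b' 1)) = Θ' (entryMap a a' (single b b' 1)) := by
    intro a a' b b'
    refine Matrix.ext_linearMap ℂ fun c c' => LinearMap.ext_ring ?_
    ext y y'
    exact congrFun₂ h (((a, c), b), y) (((a', c'), b'), y')
  have hentry : ∀ (a a' : A),
      Θ ∘ₗ LinearMap.smulRightₗ (entryLinearMap ℂ ℂ a a') =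
        Θ' ∘ₗ LinearMap.smulRightₗ (entryLinearMap ℂ ℂ a a') := fun a a' =>
    Matrix.ext_linearMap ℂ fun b b' => LinearMap.ext_ring (hunit a a' b b')
  ext N : 1
  rw [eq_sum_entryMap N]
  simp only [map_sum]
  exact Finset.sum_congr rfl fun a _ => Finset.sum_congr rfl fun a' _ =>
    LinearMap.congr_fun (hentry a a') (N (single a a' 1))

theorem component_conj_maxEntangled [Fintype A] [DecidableEq A] [DecidableEq B]
    (a a' : A) (b b' : B) :
    component (conj (vecMulVec (maxEntangled B) (maxEntangled A))) a a' b b' =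
      entryMap a a' (single b b' 1) := by
  ext X y y'
  change (vecMulVec (maxEntangled B) (maxEntangled A) * X ⊗ₖ single a a' 1 *
    (vecMulVec (maxEntangled B) (maxEntangled A))ᴴ : Op (B × B)) (y, b) (y', b') =
    X a a' * single b b' 1 y y'
  have hX : maxEntangled A ᵥ* (X ⊗ₖ single a a' 1) ⬝ᵥ star (maxEntangled A) = X a a' := by
    simp [maxEntangled, dotProduct, vecMul, Fintype.sum_prod_type, single_apply, ite_and]
  rw [conjTranspose_vecMulVec, vecMulVec_mul, vecMulVec_mul_vecMulVec, hX]
  by_cases hy : y = b <;> by_cases hy' : y' = b' <;>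
    simp [vecMulVec_apply, maxEntangled, hy, hy', eq_comm (a := b), eq_comm (a := b')]

theorem blockR_extend {C₀ C₁ : Type} [Fintype C₀] [DecidableEq C₀] (Θ : Supermap A B A' B')
    (N : Op (A × C₀) →ₗ[ℂ] Op (B × C₁)) (Y : Op (A' × C₀)) (c₁ c₁' : C₁) :
    blockR (extend Θ N Y) c₁ c₁' =
      ∑ c₀, ∑ c₀', Θ (component N c₀ c₀' c₁ c₁') (blockR Y c₀ c₀') := by
  ext b b'
  simp [blockR, extend, Matrix.sum_apply]

theorem blockR_extend_conj_maxEntangled_single [Fintype A] [DecidableEq A] [DecidableEq B]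
    [DecidableEq A'] (Θ : Supermap A B A' B') (a a' : A) (b b' : B) (c c' : A') :
    blockR (extend Θ (conj (vecMulVec (maxEntangled B) (maxEntangled A)))
        (single (c, a) (c', a') 1)) b b' =
      Θ (entryMap a a' (single b b' 1)) (single c c' 1) := by
  simp only [blockR_extend, component_conj_maxEntangled, blockR_single]
  rw [Fintype.sum_eq_single a, Fintype.sum_eq_single a'] <;> simp +contextual [eq_comm]

theorem IsSuperchannel.posSemidef_choi [Fintype A] [Fintype B] [DecidableEq B]
    [Fintype A'] [DecidableEq A'] [Fintype B'] {Θ : Supermap A B A' B'}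
    (hΘ : IsSuperchannel Θ) : (choi Θ).PosSemidef := by
  classical
  have h := (hΘ.1 A B _
    (isCP_conj (vecMulVec (maxEntangled B) (maxEntangled A)))).posSemidef_choi
  convert h.submatrix (fun p : ((A × A') × B) × B' => ((p.2, p.1.2), (p.1.1.2, p.1.1.1))) using 1
  ext ⟨⟨⟨a, c⟩, b⟩, d⟩ ⟨⟨⟨a', c'⟩, b'⟩, d'⟩
  exact congrFun₂ (blockR_extend_conj_maxEntangled_single Θ a a' b b' c c').symm d d'

end Supermap

section Uniform

open Submodule

variable {A X B C : Type} [Fintype B] [DecidableEq B]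

/-- The completely depolarizing map `X ↦ Tr(X) u^B`. -/
noncomputable def depolarize (A B : Type) [Fintype A] [Fintype B] [DecidableEq B] :
    Op A →ₗ[ℂ] Op B :=
  (traceLinearMap A ℂ ℂ).smulRight (uniform B)

theorem sum_entryMap_uniform [Fintype A] :
    ∑ a : A, entryMap a a (uniform B) = depolarize A B := by
  ext X : 1
  simp only [LinearMap.sum_apply, entryMap_apply, ← Finset.sum_smul]
  rfl

variable [Nonempty B]

theorem trace_uniform : (uniform B).trace = 1 := by
  rw [uniform, trace_smul, trace_one, smul_eq_mul,
    inv_mul_cancel₀ (Nat.cast_ne_zero.2 Fintype.card_ne_zero)]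

theorem isState_uniform : IsState (uniform B) :=
  ⟨PosSemidef.one.smul (inv_nonneg.2 (Nat.cast_nonneg _)), trace_uniform⟩

theorem card_smul_uniform : (Fintype.card B : ℂ) • uniform B = 1 :=
  smul_inv_smul₀ (Nat.cast_ne_zero.2 Fintype.card_ne_zero) 1

theorem mem_span_uniform_iff {M : Op B} : M ∈ ℂ ∙ uniform B ↔ M = M.trace • uniform B := by
  refine ⟨fun h => ?_, fun h => mem_span_singleton.2 ⟨M.trace, h.symm⟩⟩
  obtain ⟨z, rfl⟩ := mem_span_singleton.1 h
  rw [trace_smul, trace_uniform, smul_eq_mul, mul_one]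

theorem isMarginallyUniform_iff {N : Op X →ₗ[ℂ] Op (B × C)} :
    IsMarginallyUniform N ↔ ∀ ρ c c', blockR (N ρ) c c' ∈ ℂ ∙ uniform B := by
  have h : ∀ ρ c c', blockR (uniform B ⊗ₖ trLeft (N ρ)) c c' =
      (blockR (N ρ) c c').trace • uniform B := fun ρ c c' => by
    have htr : trLeft (N ρ) c c' = (blockR (N ρ) c c').trace := Matrix.sum_apply _ _ _ _
    ext b b'
    exact (mul_comm _ _).trans (congrArg (· * _) htr)
  simp only [mem_span_uniform_iff, ← h]
  refine forall_congr' fun ρ => ⟨fun hρ c c' => congrArg (blockR · c c') hρ, fun hρ => ?_⟩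
  ext ⟨b, c⟩ ⟨b', c'⟩
  exact congrFun₂ (hρ c c') b b'

theorem isChannel_uniformId [Fintype A] : IsChannel (uniformId A B) := by
  have h : uniformId A B = kroneckerBilinear (R := ℂ) (uniform B) ∘ₗ trRight A Unit := by
    ext1 ρ
    change uniform B ⊗ₖ blockR ρ () () = uniform B ⊗ₖ ∑ c, blockR ρ c c
    rw [Fintype.sum_unique]
  rw [h]
  exact (isChannel_kronecker_left isState_uniform).comp isChannel_trRight

theorem isMarginallyUniform_uniformId : IsMarginallyUniform (uniformId A B) :=
  isMarginallyUniform_iff.2 fun ρ a a' => mem_span_singleton.2 ⟨ρ (a, ()) (a', ()), by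
    ext b b'
    exact mul_comm _ _⟩

theorem isTP_depolarize [Fintype A] : IsTP (depolarize A B) := fun X => by
  change (X.trace • uniform B).trace = X.trace
  rw [trace_smul, trace_uniform, smul_eq_mul, mul_one]

end Uniform

section Marginal

variable {A A' B B' : Type} [Fintype A] [Fintype A'] [Fintype B] [Fintype B']

theorem IsSuperchannel.trace_apply_eq_of_trace_eq [Nonempty B] {Θ : Supermap A B A' B'}
    (hΘ : IsSuperchannel Θ) {N N' : Op A →ₗ[ℂ] Op B}
    (h : ∀ X, (N X).trace = (N' X).trace) (ρ : Op A') : (Θ N ρ).trace = (Θ N' ρ).trace := by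
  classical
  have hTP : IsTP (depolarize A B + (N - N')) := fun X => by
    rw [LinearMap.add_apply, LinearMap.sub_apply, trace_add, trace_sub, h, sub_self, add_zero,
      isTP_depolarize]
  have hρ := (hΘ.2 _ hTP ρ).trans (hΘ.2 _ isTP_depolarize ρ).symm
  rwa [map_add, map_sub, LinearMap.add_apply, LinearMap.sub_apply, trace_add, trace_sub,
    add_eq_left, sub_eq_zero] at hρ

/-- The marginal of the Choi matrix of `Θ` on the two inputs `A ⊗ A'`, obtained by feeding `Θ`
with maps of output `u^B` and tracing out the output. -/
noncomputable def marginalChoi [DecidableEq A'] [DecidableEq B] (Θ : Supermap A B A' B') :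
    Op (A × A') :=
  Matrix.of fun p q => (Θ (entryMap p.1 q.1 (uniform B)) (single p.2 q.2 1)).trace

variable [DecidableEq A'] [DecidableEq B] [Nonempty B] {Θ : Supermap A B A' B'}

theorem IsSuperchannel.trRight_choi (hΘ : IsSuperchannel Θ) :
    trRight _ B' (choi Θ) = marginalChoi Θ ⊗ₖ 1 := by
  ext ⟨⟨a, c⟩, b⟩ ⟨⟨a', c'⟩, b'⟩
  have htrace : ∀ X : Op A, (entryMap a a' (single b b' 1) X).trace =
      (((1 : Op B) b b' • entryMap a a' (uniform B)) X).trace := fun X => by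
    rw [LinearMap.smul_apply, entryMap_apply, entryMap_apply]
    simp only [trace_smul, trace_single_one, trace_uniform, smul_eq_mul, mul_one, mul_comm]
  rw [trRight_apply]
  refine (hΘ.trace_apply_eq_of_trace_eq htrace (single c c' 1)).trans ?_
  rw [map_smul, LinearMap.smul_apply, trace_smul, smul_eq_mul, mul_comm]
  rfl

theorem IsSuperchannel.trLeft_marginalChoi (hΘ : IsSuperchannel Θ) :
    trLeft (marginalChoi Θ) = 1 := by
  ext c c'
  calc trLeft (marginalChoi Θ) c c'
      = ∑ a, (Θ (entryMap a a (uniform B)) (single c c' 1)).trace := Matrix.sum_apply _ _ _ _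
    _ = (Θ (depolarize A B) (single c c' 1)).trace := by
        rw [← sum_entryMap_uniform, map_sum, LinearMap.sum_apply, trace_sum]
    _ = (single c c' (1 : ℂ)).trace := hΘ.2 _ isTP_depolarize _
    _ = (1 : Op A') c c' := trace_single_one c c'

theorem IsSuperchannel.posSemidef_marginalChoi (hΘ : IsSuperchannel Θ) :
    (marginalChoi Θ).PosSemidef := by
  classical
  obtain ⟨b⟩ := ‹Nonempty B›
  have h := isChannel_trRight.1.posSemidef_apply hΘ.posSemidef_choi
  rw [hΘ.trRight_choi] at h
  convert h.submatrix fun p => (p, b) using 1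
  ext p q
  simp

end Marginal

section Realization

variable {A A' B B' R : Type}

/-- The supermap `N ↦ E ∘ (id_R ⊗ N) ∘ 𝒱`, where `𝒱(ρ) = V ρ V†`. -/
def realizedBy [Fintype A'] (E : Op (R × B) →ₗ[ℂ] Op B') (V : Matrix (R × A) A' ℂ) :
    Supermap A B A' B' where
  toFun N := E ∘ₗ idTensor R N ∘ₗ conj V
  map_add' M N := by
    ext1 ρ
    exact map_add E _ _
  map_smul' z N := by
    ext1 ρ
    exact map_smul E _ _

/-- The matrix whose columns are the vectors `(id ⊗ ⟨a|) V |c⟩` of the auxiliary system `R`. -/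
def ancilla (V : Matrix (R × A) A' ℂ) : Matrix R (A × A') ℂ :=
  Matrix.of fun r p => V (r, p.1) p.2

theorem ancilla_injective : Function.Injective (ancilla : Matrix (R × A) A' ℂ → _) :=
  fun _ _ h => by
    ext ⟨r, a⟩ c
    exact congrFun₂ h r (a, c)

theorem ancilla_kronecker_mul {S : Type} [Fintype A] [DecidableEq A] [Fintype R]
    (W : Matrix S R ℂ) (V : Matrix (R × A) A' ℂ) :
    ancilla (W ⊗ₖ (1 : Op A) * V) = W * ancilla V := by
  ext s ⟨a, c⟩
  simp [ancilla, mul_apply, Fintype.sum_prod_type, one_apply]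

theorem conj_ancilla_single [Fintype A] [DecidableEq A] [Fintype A'] [DecidableEq A']
    (V : Matrix (R × A) A' ℂ) (a a' : A) (c c' : A') :
    conj (ancilla V) (single (a, c) (a', c') 1) = blockR (conj V (single c c' 1)) a a' := by
  ext r r'
  exact (conj_single_apply _ _ _ _ _).trans (conj_single_apply V c c' (r, a) (r', a')).symm

theorem choi_realizedBy_apply [Fintype A] [DecidableEq A] [Fintype A'] [DecidableEq A']
    [Fintype B] [DecidableEq B] (E : Op (R × B) →ₗ[ℂ] Op B')
    (V : Matrix (R × A) A' ℂ) (p q : (A × A') × B) (d d' : B') :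
    choi (realizedBy E V) (p, d) (q, d') =
      E (conj (ancilla V ⊗ₖ (1 : Op B)) (single p q 1)) d d' := by
  obtain ⟨⟨a, c⟩, b⟩ := p
  obtain ⟨⟨a', c'⟩, b'⟩ := q
  have h : single ((a, c), b) ((a', c'), b') (1 : ℂ) =
      single (a, c) (a', c') 1 ⊗ₖ single b b' 1 := by
    rw [single_kronecker_single, mul_one]
  rw [h, conj_kronecker, conj_one, conj_ancilla_single]
  rfl

theorem choi_realizedBy_trRight_comp_conj [Finite A] [Fintype A'] [DecidableEq A'] [Fintype R]
    [Fintype B] [DecidableEq B] {C : Type} [Fintype C] {K : Matrix (B' × C) (R × B) ℂ}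
    {V : Matrix (R × A) A' ℂ} {S : Matrix (((A × A') × B) × B') C ℂ}
    (hS : ∀ p d k, (K * ancilla V ⊗ₖ (1 : Op B)) (d, k) p = S (p, d) k) :
    choi (realizedBy (trRight B' C ∘ₗ conj K) V) = S * Sᴴ := by
  classical
  cases nonempty_fintype A
  ext ⟨p, d⟩ ⟨q, d'⟩
  rw [choi_realizedBy_apply, LinearMap.comp_apply, ← LinearMap.comp_apply (conj K), ← conj_mul,
    trRight_apply]
  simp only [conj_single_apply, hS]
  rfl

theorem trLeft_ancilla_transpose_mul [Fintype A] [Fintype R] (V : Matrix (R × A) A' ℂ) :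
    trLeft ((ancilla V)ᵀ * (ancilla V)ᵀᴴ) = (Vᴴ * V)ᵀ := by
  ext c c'
  simp only [trLeft, blockL, ancilla, Matrix.sum_apply, of_apply, mul_apply, transpose_apply,
    conjTranspose_apply, Fintype.sum_prod_type_right, mul_comm]

theorem IsSuperchannel.exists_realizedBy [Fintype A] [Fintype B] [Nonempty B] [Fintype A']
    [DecidableEq A'] [Fintype B'] {Θ : Supermap A B A' B'} (hΘ : IsSuperchannel Θ) :
    ∃ (r : ℕ) (E : Op (Fin r × B) →ₗ[ℂ] Op B') (V : Matrix (Fin r × A) A' ℂ),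
      IsChannel E ∧ Vᴴ * V = 1 ∧ Θ = realizedBy E V := by
  classical
  obtain ⟨S, hS⟩ := exists_eq_mul_conjTranspose_of_posSemidef hΘ.posSemidef_choi
  obtain ⟨r, T, L, hT, hLT⟩ :=
    exists_leftInvertible_mul_conjTranspose_of_posSemidef hΘ.posSemidef_marginalChoi
  let M : Matrix ((A × A') × B) (B' × (((A × A') × B) × B')) ℂ :=
    Matrix.of fun p dk => S (p, dk.1) dk.2
  have hM : M * Mᴴ = T ⊗ₖ (1 : Op B) * (T ⊗ₖ (1 : Op B))ᴴ := by
    rw [← trRight_mul_conjTranspose (S := S) fun _ _ _ => rfl, ← hS, hΘ.trRight_choi, hT,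
      conjTranspose_kronecker, ← mul_kronecker_mul, conjTranspose_one, Matrix.mul_one]
  have hL : L ⊗ₖ (1 : Op B) * T ⊗ₖ (1 : Op B) = 1 := by
    rw [← mul_kronecker_mul, hLT, Matrix.mul_one, one_kronecker_one]
  obtain ⟨W, hW, hTW⟩ := exists_coisometry_of_mul_conjTranspose_eq hM hL
  let V : Matrix (Fin r × A) A' ℂ := Matrix.of fun ra c => T (ra.2, c) ra.1
  have hWT : Wᵀ * ancilla V ⊗ₖ (1 : Op B) = Mᵀ := by
    rw [← hTW, transpose_mul, ← kroneckerMap_transpose, transpose_one]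
    rfl
  refine ⟨r, trRight B' _ ∘ₗ conj Wᵀ, V, isChannel_trRight.comp (isChannel_conj ?_), ?_, ?_⟩
  · rw [conjTranspose_transpose_eq_transpose_conjTranspose, ← transpose_mul, hW, transpose_one]
  · rw [← transpose_inj, ← trLeft_ancilla_transpose_mul, transpose_one,
      ← hΘ.trLeft_marginalChoi, hT]
    rfl
  · refine choi_injective ?_
    rw [hS, choi_realizedBy_trRight_comp_conj fun p d k => congrFun₂ hWT (d, k) p]

end Realization

section StandardForm

variable {A A' B R : Type} [Fintype A] [Fintype B] [Fintype A'] [DecidableEq A'] [Fintype R]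
  {Θ : Supermap A B A' B} {E : Op (R × B) →ₗ[ℂ] Op B} {V : Matrix (R × A) A' ℂ}

theorem isRealization_iff :
    IsRealization Θ E V ↔ IsChannel E ∧ Vᴴ * V = 1 ∧ Θ = realizedBy E V := by
  rw [IsRealization, LinearMap.ext_iff]
  rfl

theorem IsSuperchannel.exists_isStandardForm [Nonempty B] (hΘ : IsSuperchannel Θ) :
    ∃ (r : ℕ) (E : Op (Fin r × B) →ₗ[ℂ] Op B) (V : Matrix (Fin r × A) A' ℂ),
      IsStandardForm Θ E V := by
  classical
  have hex : ∃ (r : ℕ) (E : Op (Fin r × B) →ₗ[ℂ] Op B) (V : Matrix (Fin r × A) A' ℂ),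
      IsRealization Θ E V := by
    simpa only [isRealization_iff] using hΘ.exists_realizedBy
  obtain ⟨E, V, h⟩ := Nat.find_spec hex
  exact ⟨_, E, V, h, fun r E' V' h' =>
    (Fintype.card_fin _).trans_le (Nat.find_min' hex ⟨E', V', h'⟩)⟩

theorem IsRealization.compress {S : Type} [Fintype S] [DecidableEq S] [DecidableEq A]
    [DecidableEq B] (h : IsRealization Θ E V) {W : Matrix R S ℂ} (hW : Wᴴ * W = 1)
    (hWV : W * Wᴴ * ancilla V = ancilla V) :
    IsRealization Θ (E ∘ₗ conj (W ⊗ₖ (1 : Op B))) (Wᴴ ⊗ₖ (1 : Op A) * V) := by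
  have hV : W ⊗ₖ (1 : Op A) * (Wᴴ ⊗ₖ (1 : Op A) * V) = V :=
    ancilla_injective <| by
      rw [ancilla_kronecker_mul, ancilla_kronecker_mul, ← Matrix.mul_assoc, hWV]
  refine ⟨h.1.comp (isChannel_conj ?_), ?_, fun N => ?_⟩
  · rw [conjTranspose_kronecker, ← mul_kronecker_mul, hW, conjTranspose_one, Matrix.mul_one,
      one_kronecker_one]
  · rw [conjTranspose_mul, conjTranspose_kronecker, conjTranspose_conjTranspose,
      conjTranspose_one, Matrix.mul_assoc, hV, h.2.1]
  · calc Θ N = E ∘ₗ (idTensor R N ∘ₗ conj (W ⊗ₖ (1 : Op A))) ∘ₗ conj (Wᴴ ⊗ₖ (1 : Op A) * V) := by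
          rw [LinearMap.comp_assoc, ← conj_mul, hV, h.2.2]
      _ = (E ∘ₗ conj (W ⊗ₖ (1 : Op B))) ∘ₗ idTensor S N ∘ₗ conj (Wᴴ ⊗ₖ (1 : Op A) * V) := by
          rw [idTensor_comp_conj, LinearMap.comp_assoc, LinearMap.comp_assoc]

theorem IsStandardForm.exists_ancilla_mul_eq_one [DecidableEq R] (h : IsStandardForm Θ E V) :
    ∃ K : Matrix (A × A') R ℂ, ancilla V * K = 1 := by
  classical
  obtain ⟨r, W, K, hW, hWV, hK⟩ := exists_isometry_onto_range (ancilla V)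
  have hle : Fintype.card R ≤ r := h.2 r _ _ (h.1.compress hW hWV)
  have hge : r ≤ Fintype.card R := by
    simpa [hW] using (rank_mul_le_right Wᴴ W).trans (rank_le_card_height W)
  have hcard : Fintype.card R = Fintype.card (Fin r) := by simp [hle.antisymm hge]
  refine ⟨K * Wᴴ, ?_⟩
  rw [← Matrix.mul_assoc, hK]
  exact (mul_eq_one_comm_of_card_eq _ _ _ hcard).2 hW

theorem IsStandardForm.span_blockR_eq_top (h : IsStandardForm Θ E V) :
    Submodule.span ℂ {X : Op R | ∃ a a' ρ, X = blockR (conj V ρ) a a'} = ⊤ := by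
  classical
  obtain ⟨K, hK⟩ := h.exists_ancilla_mul_eq_one
  rw [eq_top_iff]
  intro X _
  have hX : X = conj (ancilla V) (conj K X) := by
    rw [← LinearMap.comp_apply, ← conj_mul, hK, conj_one, LinearMap.id_apply]
  rw [hX]
  refine Matrix.induction_on' (P := fun Y => conj (ancilla V) Y ∈ _) (conj K X) ?_ ?_ ?_
  · rw [map_zero]
    exact zero_mem _
  · intro Y Z hY hZ
    rw [map_add]
    exact add_mem hY hZ
  · rintro ⟨a, c⟩ ⟨a', c'⟩ z
    rw [← mul_one z, ← smul_eq_mul, ← smul_single, map_smul, conj_ancilla_single]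
    exact Submodule.smul_mem _ _ (Submodule.subset_span ⟨a, a', _, rfl⟩)

end StandardForm

section Mixing

open Submodule

variable {A A' B R : Type} [Fintype A] [Fintype B] [DecidableEq B] [Nonempty B]
  [Fintype A'] [DecidableEq A'] [Fintype R]
  {Θ : Supermap A B A' B} {E : Op (R × B) →ₗ[ℂ] Op B} {V : Matrix (R × A) A' ℂ}

theorem isConditionallyUnital_iff (hE : IsChannel E) :
    IsConditionallyUnital E ↔ ∀ X : Op R, E (X ⊗ₖ uniform B) ∈ ℂ ∙ uniform B := by
  constructor
  · intro h
    refine apply_kronecker_mem_of_span_eq_top (span_isState R) fun τ hτ => ?_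
    have h1 : E (τ ⊗ₖ 1) = 1 := (h τ hτ).2
    rw [uniform, kronecker_smul, map_smul, h1]
    exact mem_span_singleton_self _
  · intro h τ hτ
    have hu : E (τ ⊗ₖ uniform B) = uniform B := by
      rw [mem_span_uniform_iff.1 (h τ), hE.2, trace_kronecker, hτ.2, trace_uniform, mul_one,
        one_smul]
    refine ⟨isChannel_condMap hE hτ, ?_⟩
    change E (τ ⊗ₖ 1) = 1
    rw [← card_smul_uniform, kronecker_smul, map_smul, hu]

theorem IsRealization.apply_smulRight_uniform_mem (h : IsRealization Θ E V)
    (hE : IsConditionallyUnital E) (f : Op A →ₗ[ℂ] ℂ) (ρ : Op A') :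
    Θ (f.smulRight (uniform B)) ρ ∈ ℂ ∙ uniform B := by
  rw [isConditionallyUnital_iff h.1] at hE
  rw [h.2.2]
  exact hE (Matrix.of fun r r' => f (blockL (conj V ρ) r r'))

theorem IsRealization.isCompletelyUniformityPreserving (h : IsRealization Θ E V)
    (hE : IsConditionallyUnital E) : IsCompletelyUniformityPreserving Θ := by
  intro C₀ C₁ _ _ _ _ N _ hN
  rw [isMarginallyUniform_iff] at hN ⊢
  intro Y c₁ c₁'
  rw [blockR_extend]
  refine sum_mem fun c₀ _ => sum_mem fun c₀' _ => ?_
  have hcomp : component N c₀ c₀' c₁ c₁' =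
      (traceLinearMap B ℂ ℂ ∘ₗ component N c₀ c₀' c₁ c₁').smulRight (uniform B) :=
    LinearMap.ext fun X => mem_span_uniform_iff.1 (hN (X ⊗ₖ single c₀ c₀' 1) c₁ c₁')
  rw [hcomp]
  exact h.apply_smulRight_uniform_mem hE _ _

theorem IsRealization.apply_blockR_kronecker_uniform_mem (h : IsRealization Θ E V)
    (hΘ : IsMarginallyUniform (extend Θ (uniformId A B))) (a a' : A) (ρ : Op A') :
    E (blockR (conj V ρ) a a' ⊗ₖ uniform B) ∈ ℂ ∙ uniform B := by
  have hcomp : component (uniformId A B) () () a a' = entryMap a a' (uniform B) := by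
    ext X b b'
    simp [component, uniformId, blockR, entryMap, mul_comm]
  have hΘρ := isMarginallyUniform_iff.1 hΘ (ρ.submatrix Prod.fst Prod.fst) a a'
  rw [blockR_extend, Fintype.sum_unique, Fintype.sum_unique, hcomp, h.2.2] at hΘρ
  exact hΘρ

theorem IsStandardForm.isConditionallyUnital (h : IsStandardForm Θ E V)
    (hΘ : IsMarginallyUniform (extend Θ (uniformId A B))) : IsConditionallyUnital E := by
  rw [isConditionallyUnital_iff h.1.1]
  refine apply_kronecker_mem_of_span_eq_top h.span_blockR_eq_top ?_
  rintro _ ⟨a, a', ρ, rfl⟩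
  exact h.1.apply_blockR_kronecker_uniform_mem hΘ a a' ρ

end Mixing

end QChan

theorem theorem11 {A A' B : Type} [Fintype A] [DecidableEq A] [Nonempty A]
    [Fintype A'] [DecidableEq A'] [Nonempty A'] [Fintype B] [DecidableEq B] [Nonempty B]
    (Θ : QChan.Supermap A B A' B) (hΘ : QChan.IsSuperchannel Θ) :
    [QChan.IsCompletelyUniformityPreserving Θ,
      QChan.IsMarginallyUniform (QChan.extend Θ (QChan.uniformId A B)),
      QChan.IsMixing Θ].TFAE ∧
    ∀ (R : Type) [Fintype R] [DecidableEq R] (E : QChan.Op (R × B) →ₗ[ℂ] QChan.Op B)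
      (V : Matrix (R × A) A' ℂ), QChan.IsStandardForm Θ E V →
      (QChan.IsConditionallyUnital E ↔ QChan.IsCompletelyUniformityPreserving Θ) := by
  have h12 : QChan.IsCompletelyUniformityPreserving Θ →
      QChan.IsMarginallyUniform (QChan.extend Θ (QChan.uniformId A B)) := fun h =>
    h Unit A _ QChan.isChannel_uniformId QChan.isMarginallyUniform_uniformId
  refine ⟨?_, fun R _ _ E V hEV => ⟨fun h => hEV.1.isCompletelyUniformityPreserving h,
    fun h => hEV.isConditionallyUnital (h12 h)⟩⟩
  tfae_have 1 → 2 := h12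
  tfae_have 2 → 3 := fun h => by
    obtain ⟨r, E, V, hEV⟩ := hΘ.exists_isStandardForm
    exact ⟨r, E, V, hEV, hEV.isConditionallyUnital h⟩
  tfae_have 3 → 1 := fun ⟨r, E, V, hEV, h⟩ => hEV.1.isCompletelyUniformityPreserving h
  tfae_finish
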